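/- Let $V$ be a real vector space of finite dimension $n\ge 1$ with dual $V^*$, and let $K\subset V$ and $T\subset V^*$ be smooth convex bodies (compact convex sets with nonempty interior having a unique supporting hyperplane at each boundary point), where $T$ contains the origin in its interior. Let $\|q\|_T=\max_{p\in T}\langle p,q\rangle$ be the (possibly asymmetric) norm on $V$ whose unit ball is the polar $T^\circ$, and for a closed polygonal line $(q_1,\dots,q_m)$ in $V$ put $$\ell_T(q_1,\dots,q_m)=\sum_{i=1}^m\|q_{i+1}-q_i\|_T ,$$ with indices modulo $m$. Let $$\mathcal P_m(K)=\{(q_1,\dots,q_m)\in V^m:\ \{q_1,\dots,q_m\}\not\subseteq \alpha K+t\ \text{ for all } \alpha\in(0,1),\ t\in V\}.$$ A closed billiard trajectory in $K$ with norm $\|\cdot\|_T$ is a closed polygonal line $(q_1,\dots,q_m)$ with $q_i\in\partial K$ and $q_{i+1}\neq q_i$ for all $i$ (indices modulo $m$), for which there are momenta $p_1,\dots,p_m\in\partial T$ with $\langle p_i,q_i-q_{i-1}\rangle=\|q_i-q_{i-1}\|_T$ (that is, $p_i=d\|\cdot\|_T$ at $q_i-q_{i-1}$ whenever this differential exists)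 satisfying the reflection rule $$p_{i+1}-p_i=-\lambda_i\,n_K(q_i),\qquad \lambda_i>0,$$ where $n_K(q_i)$ is an outer normal of $K$ at $q_i$, i.e. a nonzero functional in $V^*$ that attains its maximum over $K$ at $q_i$. Then a shortest closed billiard trajectory in $K$ exists, and its length $\ell_T$ equals $$\xi_T(K)=\min_{m\ge 1}\ \min_{P\in\mathcal P_m(K)}\ell_T(P),$$ where $\mathcal P_1(K)=\emptyset$ and all the minima over $\mathcal P_m(K)$, $m\ge2$, and over $m$ exist. Moreover, the minimum is attained at some $m\le n+1$. -/

import Mathlib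

open scoped Pointwise

namespace MinkowskiBilliard

/-- `f` is an outer normal of the set `K` at its point `x`: a nonzero linear functional that
attains its maximum over `K` at `x`.  (If `K` is a convex body with nonempty interior, then such
an `f` exists precisely when `x` is a boundary point of `K`.) -/
def IsOuterNormal {E : Type*} [NormedAddCommGroup E] [NormedSpace ℝ E]
    (K : Set E) (f : StrongDual ℝ E) (x : E) : Prop :=
  f ≠ 0 ∧ x ∈ K ∧ ∀ y ∈ K, f y ≤ f x

/-- Smoothness of a convex body: at each boundary point there is only one supporting hyperplane,
i.e. the outer normal is unique up to a positive factor (equivalently, the boundary is `C^1`). -/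
def IsSmoothBody {E : Type*} [NormedAddCommGroup E] [NormedSpace ℝ E] (K : Set E) : Prop :=
  ∀ x ∈ frontier K, ∀ f g : StrongDual ℝ E,
    IsOuterNormal K f x → IsOuterNormal K g x → ∃ c : ℝ, 0 < c ∧ g = c • f

section

variable {V : Type*} [NormedAddCommGroup V] [NormedSpace ℝ V]

/-- The possibly asymmetric norm `‖q‖_T = max {⟨p, q⟩ : p ∈ T}` on `V` given by a body `T` in the
dual space of `V`; its unit ball is the polar `T° = {q : ⟨p, q⟩ ≤ 1 for all p ∈ T}`.
It is unrelated to the norm `‖q‖` that `V` carries, which only serves to fix the topology of the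
finite-dimensional space `V`. -/
noncomputable def asymNorm (T : Set (StrongDual ℝ V)) (q : V) : ℝ :=
  sSup ((fun p : StrongDual ℝ V => p q) '' T)

/-- The length `ℓ_T(q₁, …, q_m) = ∑ i, ‖q_{i+1} - q_i‖_T` of a closed polygonal line; the indices
are cyclic, `finRotate m i` being `i + 1` modulo `m`. -/
noncomputable def polygonLength (T : Set (StrongDual ℝ V)) {m : ℕ} (q : Fin m → V) : ℝ :=
  ∑ i, asymNorm T (q (finRotate m i) - q i)

/-- `S` fits into a smaller positive homothet `α K + t`, `0 < α < 1`, of `K`. -/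
def FitsInSmallerHomothet (K S : Set V) : Prop :=
  ∃ α : ℝ, 0 < α ∧ α < 1 ∧ ∃ t : V, S ⊆ α • K + {t}

/-- `𝒫_m(K)`: the closed polygons with `m` vertices whose vertex set does not fit into a smaller
positive homothet of `K`. -/
def nonFittingPolygons (K : Set V) (m : ℕ) : Set (Fin m → V) :=
  {q | ¬ FitsInSmallerHomothet K (Set.range q)}

/-- `p` is a momentum for the nonzero displacement `v`: a boundary point `p` of `T` with
`⟨p, v⟩ = ‖v‖_T`, i.e. a subgradient of `‖·‖_T` at `v`.
Where `‖·‖_T` is differentiable (everywhere off `0` if `T` is strictly convex) this says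
`p = d‖v‖_T`; conversely, for smooth `T` it says that the normalized velocity `v / ‖v‖_T` is the
differential at `p` of the gauge of `T`. -/
def IsMomentum (T : Set (StrongDual ℝ V)) (v : V) (p : StrongDual ℝ V) : Prop :=
  p ∈ frontier T ∧ p v = asymNorm T v

/-- `(q₁, …, q_m)` is a closed billiard trajectory in `K` with respect to `‖·‖_T`: consecutive
vertices are different, the vertices are on the boundary of `K`, and there are momenta `p_i` of the
displacements `q_i - q_{i-1}` obeying the reflection rule `p_{i+1} - p_i = - λ_i n_K(q_i)` with
`λ_i > 0` and `n_K(q_i)` an outer normal of `K` at `q_i` (its normalization is absorbed in `λ_i`).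
Indices are cyclic. -/
def IsClosedBilliardTrajectory (K : Set V) (T : Set (StrongDual ℝ V)) {m : ℕ}
    (q : Fin m → V) : Prop :=
  (∀ i, q (finRotate m i) ≠ q i) ∧
  (∀ i, q i ∈ frontier K) ∧
  ∃ p : Fin m → StrongDual ℝ V,
    (∀ i, IsMomentum T (q (finRotate m i) - q i) (p (finRotate m i))) ∧
    ∀ i, ∃ (lam : ℝ) (ν : StrongDual ℝ V), 0 < lam ∧ IsOuterNormal K ν (q i) ∧
      p (finRotate m i) - p i = -(lam • ν)

end

end MinkowskiBilliard

/-! Around a closed trajectory the momenta differences telescope, so positive multiples of the outer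
normals sum to zero. A translation moving all vertices into the interior of `K` would lower every
term of `∑ f_i(q_i)` while preserving the sum of the translation terms; hence trajectories do not
fit, and they are at least as long as the minimum.

Conversely, take a shortest non-fitting polygon with fewest vertices. Homogeneity lets it be
translated into `K`, and Hahn–Banach (`exists_normals_sum_eq_zero`) supplies functionals `f_i` with
zero sum; having fewest vertices makes all of them nonzero. Every polygon with `∑ f_i(q'_i) ≥ C = ∑
f_i(q_i)` is non-fitting, so `(ξ/C) f` is dominated by `ℓ_T`. Since `ℓ_T` is the support function of
the cyclic differences of points of `T` (`exists_momenta_of_le_polygonLength`), this functional is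
such a difference, and equality at `q` makes these points momenta.

Compactness modulo translations gives the minima; Helly's theorem bounds the number of vertices by
`n + 1`. -/

namespace MinkowskiBilliard

/-! ### The asymmetric norm as a support function -/

section asymNorm

variable {V : Type*} [NormedAddCommGroup V] [NormedSpace ℝ V]
  (T : ConvexBody (StrongDual ℝ V))

lemma apply_le_asymNorm {p : StrongDual ℝ V} (hp : p ∈ T) (v : V) :
    p v ≤ asymNorm (T : Set _) v := by
  refine le_csSup ?_ ⟨p, hp, rfl⟩
  exact (T.isCompact.image (by fun_prop : Continuous fun p : StrongDual ℝ V => p v)).bddAbove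

lemma exists_apply_eq_asymNorm (v : V) : ∃ p ∈ T, p v = asymNorm (T : Set _) v :=
  (T.isCompact.image (by fun_prop : Continuous fun p : StrongDual ℝ V => p v)).sSup_mem
    (T.nonempty.image _)

lemma asymNorm_add_le (v w : V) :
    asymNorm (T : Set _) (v + w) ≤ asymNorm (T : Set _) v + asymNorm (T : Set _) w := by
  obtain ⟨p, hp, h⟩ := exists_apply_eq_asymNorm T (v + w)
  rw [← h, map_add]
  exact add_le_add (apply_le_asymNorm T hp v) (apply_le_asymNorm T hp w)

lemma asymNorm_smul {c : ℝ} (hc : 0 ≤ c) (v : V) :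
    asymNorm (T : Set _) (c • v) = c * asymNorm (T : Set _) v := by
  apply le_antisymm
  · obtain ⟨p, hp, h⟩ := exists_apply_eq_asymNorm T (c • v)
    rw [← h, map_smul, smul_eq_mul]
    exact mul_le_mul_of_nonneg_left (apply_le_asymNorm T hp v) hc
  · obtain ⟨p, hp, h⟩ := exists_apply_eq_asymNorm T v
    rw [← h, ← smul_eq_mul, ← map_smul]
    exact apply_le_asymNorm T hp _

lemma asymNorm_zero : asymNorm (T : Set _) (0 : V) = 0 := by
  simpa using asymNorm_smul T le_rfl (0 : V)

lemma continuous_asymNorm : Continuous (asymNorm (T : Set (StrongDual ℝ V))) := by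
  refine T.isCompact.continuous_sSup (f := fun (v : V) (p : StrongDual ℝ V) => p v) ?_
  change Continuous fun x : V × StrongDual ℝ V => x.2 x.1
  fun_prop

variable {T}

/-- A small multiple of a norming functional lies in `T`. This coercivity underlies the compactness
argument. -/
lemma exists_mul_norm_le_asymNorm (hT0 : (0 : StrongDual ℝ V) ∈ interior (T : Set _)) :
    ∃ c : ℝ, 0 < c ∧ ∀ v : V, c * ‖v‖ ≤ asymNorm (T : Set _) v := by
  obtain ⟨r, hr, hball⟩ := Metric.isOpen_iff.1 isOpen_interior _ hT0
  refine ⟨r / 2, by positivity, fun v => ?_⟩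
  obtain ⟨g, hg, hgv⟩ := exists_dual_vector'' ℝ v
  have hmem : (r / 2) • g ∈ T := by
    refine interior_subset (hball ?_)
    rw [mem_ball_zero_iff, norm_smul, Real.norm_of_nonneg (by positivity)]
    nlinarith
  have := apply_le_asymNorm T hmem v
  simpa [hgv] using this

lemma asymNorm_nonneg (hT0 : (0 : StrongDual ℝ V) ∈ interior (T : Set _)) (v : V) :
    0 ≤ asymNorm (T : Set _) v := by
  simpa using apply_le_asymNorm T (interior_subset hT0) v

lemma asymNorm_pos (hT0 : (0 : StrongDual ℝ V) ∈ interior (T : Set _)) {v : V} (hv : v ≠ 0) :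
    0 < asymNorm (T : Set _) v := by
  obtain ⟨c, hc, h⟩ := exists_mul_norm_le_asymNorm hT0
  exact (mul_pos hc (norm_pos_iff.2 hv)).trans_le (h v)

end asymNorm

/-! ### Length of closed polygons -/

section polygonLength

variable {V : Type*} [NormedAddCommGroup V] [NormedSpace ℝ V]

lemma polygonLength_succ (S : Set (StrongDual ℝ V)) {k : ℕ} (q : Fin (k + 1) → V) :
    polygonLength S q =
      (∑ i : Fin k, asymNorm S (q i.succ - q i.castSucc)) + asymNorm S (q 0 - q (Fin.last k)) := by
  simp [polygonLength, Fin.sum_univ_castSucc]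

lemma polygonLength_rotate (S : Set (StrongDual ℝ V)) {k : ℕ} (q : Fin (k + 1) → V)
    (j : Fin (k + 1)) : polygonLength S (fun i => q (i + j)) = polygonLength S q := by
  simp only [polygonLength, finRotate_apply]
  rw [← Equiv.sum_comp (Equiv.addRight j) fun i => asymNorm S (q (i + 1) - q i)]
  simp [add_right_comm]

lemma polygonLength_add_const (S : Set (StrongDual ℝ V)) {m : ℕ} (q : Fin m → V) (t : V) :
    polygonLength S (fun i => q i + t) = polygonLength S q := by
  simp [polygonLength]

/-- Cyclic summation by parts. -/
lemma sum_sub_rotate_apply {m : ℕ} (p : Fin m → StrongDual ℝ V) (q : Fin m → V) :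
    ∑ i, (p i - p (finRotate m i)) (q i) =
      ∑ i, p (finRotate m i) (q (finRotate m i) - q i) := by
  simp only [sub_apply, map_sub, Finset.sum_sub_distrib]
  rw [Equiv.sum_comp (finRotate m) fun i => p i (q i)]

variable (T : ConvexBody (StrongDual ℝ V))

lemma polygonLength_smul {c : ℝ} (hc : 0 ≤ c) {m : ℕ} (q : Fin m → V) :
    polygonLength (T : Set _) (c • q) = c * polygonLength (T : Set _) q := by
  simp only [polygonLength, Finset.mul_sum, Pi.smul_apply, ← smul_sub, asymNorm_smul T hc]

lemma continuous_polygonLength (m : ℕ) :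
    Continuous fun q : Fin m → V => polygonLength (T : Set _) q := by
  unfold polygonLength
  exact continuous_finsetSum _ fun i _ => (continuous_asymNorm T).comp (by fun_prop)

lemma polygonLength_tail_le {k : ℕ} (q : Fin (k + 2) → V) :
    polygonLength (T : Set _) (Fin.tail q) ≤ polygonLength (T : Set _) q := by
  rw [polygonLength_succ, polygonLength_succ, Fin.sum_univ_succ]
  have h := asymNorm_add_le T (q 1 - q 0) (q 0 - q (Fin.last (k + 1)))
  rw [sub_add_sub_cancel] at h
  simp only [Fin.tail, Fin.succ_last, Fin.succ_zero_eq_one, Fin.castSucc_zero, Fin.succ_castSucc]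
  linarith

/-- A rotation brings vertex `j` to the head, where the triangle inequality removes it. -/
lemma exists_erase_vertex {k : ℕ} (q : Fin (k + 2) → V) (j : Fin (k + 2)) :
    ∃ q' : Fin (k + 1) → V, polygonLength (T : Set _) q' ≤ polygonLength (T : Set _) q ∧
      ∀ i, i ≠ j → q i ∈ Set.range q' := by
  refine ⟨Fin.tail fun i => q (i + j),
    (polygonLength_tail_le T _).trans_eq (polygonLength_rotate _ q j), fun i hi => ?_⟩
  obtain ⟨l, hl⟩ := Fin.exists_succ_eq.2 (sub_ne_zero.2 hi)
  exact ⟨l, by simp [Fin.tail, hl]⟩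

/-- Doubling a vertex adds an edge of length zero. -/
lemma exists_add_vertex {k : ℕ} (q : Fin (k + 1) → V) :
    ∃ q' : Fin (k + 2) → V, polygonLength (T : Set _) q' = polygonLength (T : Set _) q ∧
      ∀ i, q i ∈ Set.range q' := by
  refine ⟨Fin.cons (q 0) q, ?_, fun i => ⟨i.succ, by simp⟩⟩
  rw [polygonLength_succ, polygonLength_succ, Fin.sum_univ_succ]
  simp [asymNorm_zero, ← Fin.succ_last]

variable {T}

lemma asymNorm_sub_le_polygonLength (hT0 : (0 : StrongDual ℝ V) ∈ interior (T : Set _)) {m : ℕ}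
    (q : Fin m → V) (i : Fin m) :
    asymNorm (T : Set _) (q (finRotate m i) - q i) ≤ polygonLength (T : Set _) q :=
  Finset.single_le_sum (f := fun i => asymNorm (T : Set _) (q (finRotate m i) - q i))
    (fun _ _ => asymNorm_nonneg hT0 _) (Finset.mem_univ i)

lemma polygonLength_nonneg (hT0 : (0 : StrongDual ℝ V) ∈ interior (T : Set _)) {m : ℕ}
    (q : Fin m → V) : 0 ≤ polygonLength (T : Set _) q :=
  Finset.sum_nonneg fun _ _ => asymNorm_nonneg hT0 _

lemma norm_sub_zero_le {c : ℝ} (hc : 0 < c)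
    (h : ∀ v : V, c * ‖v‖ ≤ asymNorm (T : Set _) v)
    (hT0 : (0 : StrongDual ℝ V) ∈ interior (T : Set _)) {k : ℕ} (q : Fin (k + 1) → V)
    (i : Fin (k + 1)) : ‖q i - q 0‖ ≤ i * (polygonLength (T : Set _) q / c) := by
  induction i using Fin.induction with
  | zero => simp
  | succ i ih =>
    have h1 := (h _).trans (asymNorm_sub_le_polygonLength hT0 q i.castSucc)
    rw [finRotate_apply, Fin.coeSucc_eq_succ, mul_comm, ← le_div_iff₀ hc] at h1
    have h2 := norm_add_le (q i.succ - q i.castSucc) (q i.castSucc - q 0)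
    rw [sub_add_sub_cancel] at h2
    simp only [Fin.val_succ, Fin.val_castSucc] at ih ⊢
    push_cast
    linarith

end polygonLength

/-! ### Non-fitting polygons and outer normals -/

section nonFitting

variable {V : Type*} [NormedAddCommGroup V] [NormedSpace ℝ V] {K : ConvexBody V}

/-- Shrinking `K` towards an interior point `x` lands in the interior; conversely, finitely many
interior points survive a slight expansion from `x`. This form makes fitting an open condition. -/
lemma fitsInSmallerHomothet_iff (hK : (interior (K : Set V)).Nonempty) {m : ℕ} (q : Fin m → V) :
    FitsInSmallerHomothet (K : Set V) (Set.range q) ↔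
      ∃ t, ∀ i, q i - t ∈ interior (K : Set V) := by
  obtain ⟨x, hx⟩ := hK
  constructor
  · rintro ⟨α, h0, h1, t, hS⟩
    refine ⟨t - (1 - α) • x, fun i => ?_⟩
    obtain ⟨_, ⟨y, hy, rfl⟩, _, rfl, hqi⟩ := hS ⟨i, rfl⟩
    have := K.convex.combo_interior_self_mem_interior hx hy
      (sub_pos.2 h1) h0.le (sub_add_cancel 1 α)
    convert this using 1
    rw [← hqi]
    simp only
    abel
  · rintro ⟨t, ht⟩
    have key : ∀ᶠ δ in nhdsWithin (0 : ℝ) (Set.Ioi 0), ∀ i,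
        (q i - t) + δ • (q i - t - x) ∈ (K : Set V) := by
      rw [Filter.eventually_all]
      intro i
      have hc : Filter.Tendsto (fun δ : ℝ => (q i - t) + δ • (q i - t - x)) (nhds 0)
          (nhds (q i - t)) := by
        have : Continuous fun δ : ℝ => (q i - t) + δ • (q i - t - x) := by fun_prop
        simpa using this.tendsto 0
      exact (hc.eventually (mem_interior_iff_mem_nhds.1 (ht i))).filter_mono nhdsWithin_le_nhds
    obtain ⟨δ, hδ, hpos⟩ := (key.and self_mem_nhdsWithin).exists
    have hpos : 0 < δ := hpos
    -- These data invert the expansion by `1 + δ` about `x`, then translate by `t`.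
    refine ⟨(1 + δ)⁻¹, by positivity, inv_lt_one_of_one_lt₀ (by linarith),
      t + ((1 + δ)⁻¹ * δ) • x, ?_⟩
    rintro _ ⟨i, rfl⟩
    refine ⟨_, ⟨_, hδ i, rfl⟩, _, rfl, ?_⟩
    have hne : (1 + δ) ≠ 0 := by positivity
    have : (1 + δ)⁻¹ • ((q i - t) + δ • (q i - t - x)) + (t + ((1 + δ)⁻¹ * δ) • x)
        = ((1 + δ)⁻¹ * (1 + δ)) • (q i - t) + t := by module
    simp only
    rw [this, inv_mul_cancel₀ hne]
    simp

lemma mem_nonFittingPolygons_iff (hK : (interior (K : Set V)).Nonempty) {m : ℕ} (q : Fin m → V) :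
    q ∈ nonFittingPolygons (K : Set V) m ↔ ¬ ∃ t, ∀ i, q i - t ∈ interior (K : Set V) :=
  (fitsInSmallerHomothet_iff hK q).not

lemma nonFittingPolygons_one (hK : (interior (K : Set V)).Nonempty) :
    nonFittingPolygons (K : Set V) 1 = ∅ := by
  obtain ⟨x, hx⟩ := hK
  refine Set.eq_empty_of_forall_notMem fun q hq => (mem_nonFittingPolygons_iff ⟨x, hx⟩ q).1 hq ?_
  exact ⟨q 0 - x, fun i => by simpa [Subsingleton.elim i 0] using hx⟩

lemma isClosed_nonFittingPolygons (hK : (interior (K : Set V)).Nonempty) (m : ℕ) :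
    IsClosed (nonFittingPolygons (K : Set V) m) := by
  have : nonFittingPolygons (K : Set V) m =
      (⋃ t : V, ⋂ i, (fun q : Fin m → V => q i - t) ⁻¹' interior (K : Set V))ᶜ := by
    ext q
    simp [mem_nonFittingPolygons_iff hK]
  rw [this, isClosed_compl_iff]
  exact isOpen_iUnion fun t => isOpen_iInter_of_finite fun i =>
    isOpen_interior.preimage (by fun_prop)

lemma nonFitting_of_forall_mem_range (hK : (interior (K : Set V)).Nonempty) {m m' : ℕ}
    {q : Fin m → V} {q' : Fin m' → V} (hq : q ∈ nonFittingPolygons (K : Set V) m)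
    (h : ∀ i, q i ∈ Set.range q') : q' ∈ nonFittingPolygons (K : Set V) m' := by
  rw [mem_nonFittingPolygons_iff hK] at hq ⊢
  rintro ⟨t, ht⟩
  refine hq ⟨t, fun i => ?_⟩
  obtain ⟨l, hl⟩ := h i
  exact hl ▸ ht l

lemma nonFitting_add_const (hK : (interior (K : Set V)).Nonempty) {m : ℕ}
    {q : Fin m → V} (hq : q ∈ nonFittingPolygons (K : Set V) m) (s : V) :
    (fun i => q i + s) ∈ nonFittingPolygons (K : Set V) m := by
  rw [mem_nonFittingPolygons_iff hK] at hq ⊢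
  rintro ⟨t, ht⟩
  exact hq ⟨t - s, fun i => by simpa [sub_sub_eq_add_sub] using ht i⟩

lemma nonFittingPolygons_nonempty [Nontrivial V] (hK : (interior (K : Set V)).Nonempty) (k : ℕ) :
    (nonFittingPolygons (K : Set V) (k + 2)).Nonempty := by
  obtain ⟨v, hv⟩ := NormedSpace.exists_lt_norm ℝ V (Metric.diam (K : Set V))
  refine ⟨Fin.cons 0 fun _ => v, (mem_nonFittingPolygons_iff hK _).2 ?_⟩
  rintro ⟨t, ht⟩
  have h0 := interior_subset (ht 0)
  have h1 := interior_subset (ht (Fin.succ 0))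
  have := Metric.dist_le_diam_of_mem K.isBounded h1 h0
  simp only [Fin.cons_zero, Fin.cons_succ, dist_eq_norm, sub_sub_sub_cancel_right, sub_zero] at this
  exact absurd this (not_le.2 hv)

/-- Helly's theorem: among more than `n + 1` vertices of a non-fitting polygon, one is redundant. -/
lemma exists_redundant_vertex [FiniteDimensional ℝ V] (hK : (interior (K : Set V)).Nonempty)
    {m : ℕ} (hm : Module.finrank ℝ V + 1 < m) {q : Fin m → V}
    (hq : q ∈ nonFittingPolygons (K : Set V) m) :
    ∃ j, ¬ ∃ t, ∀ i, i ≠ j → q i - t ∈ interior (K : Set V) := by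
  by_contra! hall
  rw [mem_nonFittingPolygons_iff hK] at hq
  have hne : (⋂ i ∈ (Finset.univ : Finset (Fin m)),
      (fun t => q i - t) ⁻¹' interior (K : Set V)).Nonempty := by
    -- Helly is applied to the sets of translations putting a single vertex in the interior; `n + 1`
    -- of them always omit some index `j`.
    refine Convex.helly_theorem (𝕜 := ℝ) (by simpa using hm.le) (fun i _ => ?_) fun I _ hI => ?_
    · intro a ha b hb u w hu hw huw
      have h : u • (q i - a) + w • (q i - b) ∈ interior (K : Set V) :=
        K.convex.interior ha hb hu hw huw
      have e : u • (q i - a) + w • (q i - b) = (u + w) • q i - (u • a + w • b) := by module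
      rwa [e, huw, one_smul] at h
    · obtain ⟨j, hj⟩ : ∃ j, j ∉ I := by
        by_contra! h
        have : I = Finset.univ := Finset.eq_univ_iff_forall.2 h
        rw [this, Finset.card_univ, Fintype.card_fin] at hI
        omega
      obtain ⟨t, ht⟩ := hall j
      exact ⟨t, Set.mem_iInter₂.2 fun i hi => ht i (ne_of_mem_of_not_mem hi hj)⟩
  obtain ⟨t, ht⟩ := hne
  exact hq ⟨t, fun i => Set.mem_iInter₂.1 ht i (Finset.mem_univ i)⟩

/-- A linear functional with an interior maximum has zero derivative, hence vanishes. -/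
lemma apply_lt_of_isOuterNormal {f : StrongDual ℝ V} {x y : V}
    (hf : IsOuterNormal (K : Set V) f x) (hy : y ∈ interior (K : Set V)) : f y < f x := by
  refine (hf.2.2 y (interior_subset hy)).lt_of_ne fun heq => hf.1 ?_
  have hmax : IsLocalMax f y := by
    filter_upwards [mem_interior_iff_mem_nhds.1 hy] with z hz
    exact heq ▸ hf.2.2 z hz
  exact hmax.hasFDerivAt_eq_zero f.hasFDerivAt

/-- If outer normals at the vertices of `q` sum to zero, then every polygon that lies at least as
far in their direction is non-fitting. -/
lemma nonFitting_of_sum_normals_le (hK : (interior (K : Set V)).Nonempty) {m : ℕ} (hm : 1 ≤ m)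
    {q q' : Fin m → V} {f : Fin m → StrongDual ℝ V}
    (hf : ∀ i, IsOuterNormal (K : Set V) (f i) (q i)) (hsum : ∑ i, f i = 0)
    (hle : ∑ i, f i (q i) ≤ ∑ i, f i (q' i)) : q' ∈ nonFittingPolygons (K : Set V) m := by
  rw [mem_nonFittingPolygons_iff hK]
  rintro ⟨t, ht⟩
  have hlt : ∑ i, f i (q' i - t) < ∑ i, f i (q i) :=
    Finset.sum_lt_sum_of_nonempty ⟨⟨0, hm⟩, Finset.mem_univ _⟩
      fun i _ => apply_lt_of_isOuterNormal (hf i) (ht i)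
  have h0 : ∑ i, f i t = 0 := by
    simpa using congrArg (fun g : StrongDual ℝ V => g t) hsum
  simp only [map_sub, Finset.sum_sub_distrib, h0, sub_zero] at hlt
  exact absurd hle (not_le.2 hlt)

lemma IsClosedBilliardTrajectory.mem_nonFittingPolygons (hK : (interior (K : Set V)).Nonempty)
    {S : Set (StrongDual ℝ V)} {m : ℕ} (hm : 1 ≤ m) {q : Fin m → V}
    (hq : IsClosedBilliardTrajectory (K : Set V) S q) :
    q ∈ nonFittingPolygons (K : Set V) m := by
  obtain ⟨-, -, p, -, hp⟩ := hq
  choose lam ν hlam hν hpν using hp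
  refine nonFitting_of_sum_normals_le (q := q) (f := fun i => lam i • ν i) hK hm
    (fun i => ⟨smul_ne_zero (hlam i).ne' (hν i).1, (hν i).2.1, fun y hy => ?_⟩) ?_ le_rfl
  · exact mul_le_mul_of_nonneg_left ((hν i).2.2 y hy) (hlam i).le
  · have h1 : ∀ i, lam i • ν i = p i - p (finRotate m i) := fun i => by
      rw [← neg_sub, hpν i, neg_neg]
    simp only [h1, Finset.sum_sub_distrib, Equiv.sum_comp (finRotate m) p, sub_self]

lemma continuousLinearMap_pi_apply {m : ℕ} {W : Type*} [NormedAddCommGroup W] [NormedSpace ℝ W]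
    (F : StrongDual ℝ (Fin m → W)) (a : Fin m → W) :
    F a = ∑ i, F (Pi.single i (a i)) := by
  rw [← map_sum, Finset.univ_sum_single]

/-- A non-fitting polygon inside `K` has functionals maximal on `K` at its vertices, not all zero,
that sum to zero. -/
lemma exists_normals_sum_eq_zero (hK : (interior (K : Set V)).Nonempty) {m : ℕ}
    {q : Fin m → V} (hq : q ∈ nonFittingPolygons (K : Set V) m) (hqK : ∀ i, q i ∈ K) :
    ∃ f : Fin m → StrongDual ℝ V, ∑ i, f i = 0 ∧ (∃ i, f i ≠ 0) ∧
      ∀ i, ∀ y ∈ K, f i y ≤ f i (q i) := by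
  rw [mem_nonFittingPolygons_iff hK] at hq
  obtain ⟨x, hx⟩ := hK
  -- Non-fitting means that the translates `L` of `q` miss the product `A` of interiors.
  let A : Set (Fin m → V) := Set.pi Set.univ fun _ => interior (K : Set V)
  let L : Set (Fin m → V) := Set.range fun t : V => fun i => q i - t
  have hLc : Convex ℝ L := by
    rintro _ ⟨s, rfl⟩ _ ⟨t, rfl⟩ a b ha hb hab
    refine ⟨a • s + b • t, funext fun i => ?_⟩
    have : q i = (a + b) • q i := by rw [hab, one_smul]
    simp only [Pi.add_apply, Pi.smul_apply]
    nth_rewrite 1 [this]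
    module
  have hdisj : Disjoint A L := by
    rw [Set.disjoint_left]
    rintro _ ha ⟨t, rfl⟩
    exact hq ⟨t, fun i => ha i (Set.mem_univ i)⟩
  obtain ⟨F, u, hFA, hFL⟩ := geometric_hahn_banach_open
    (convex_pi fun _ _ => K.convex.interior)
    (isOpen_set_pi Set.finite_univ fun _ _ => isOpen_interior) hLc hdisj
  let f : Fin m → StrongDual ℝ V := fun i => F.comp (ContinuousLinearMap.single ℝ (fun _ => V) i)
  have hF : ∀ a, F a = ∑ i, f i (a i) := continuousLinearMap_pi_apply F
  have hFq : u ≤ F q := by simpa using hFL _ ⟨0, rfl⟩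
  have hAK : ∀ a : Fin m → V, (∀ i, a i ∈ K) → F a ≤ F q := by
    intro a ha
    have hcl : a ∈ closure A := by
      rw [closure_pi_set]
      intro i _
      rw [K.convex.closure_interior_eq_closure_of_nonempty_interior ⟨x, hx⟩]
      exact subset_closure (ha i)
    exact closure_minimal (t := {a | F a ≤ F q}) (fun b hb => ((hFA b hb).trans_le hFq).le)
      (isClosed_le F.continuous continuous_const) hcl
  refine ⟨f, ?_, ?_, ?_⟩
  · ext t
    -- `F` is bounded below on the affine space `L`, so it vanishes on constant families.
    have hline : ∀ c : ℝ, u ≤ F q - c * F (fun _ => t) := fun c => by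
      have h : u ≤ F (q - c • fun _ => t) := hFL _ ⟨c • t, rfl⟩
      rwa [map_sub, map_smul, smul_eq_mul] at h
    have h0 : F (fun _ => t) = 0 := by
      by_contra hne
      have := hline ((F q - u + 1) / F (fun _ => t))
      rw [div_mul_cancel₀ _ hne] at this
      linarith
    rw [hF] at h0
    simpa using h0
  · by_contra! h
    have h1 := hFA (fun _ => x) fun _ _ => hx
    have h2 := h1.trans_le hFq
    simp [hF, h] at h2
  · intro i y hy
    have h := hAK (Function.update q i y) fun l => by
      rcases eq_or_ne l i with rfl | hl
      · simpa using hy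
      · simpa [hl] using hqK l
    have he : Function.update q i y = q + Pi.single i (y - q i) := by
      ext l
      rcases eq_or_ne l i with rfl | hl
      · simp
      · simp [hl]
    rw [he, map_add] at h
    have : f i (y - q i) ≤ 0 := by
      change F (Pi.single i (y - q i)) ≤ 0
      linarith
    simpa using this

/-- The families translatable into `K` form a compact set plus a subspace, which is closed, so `c →
1` is allowed. -/
lemma exists_translate_of_forall_smul [FiniteDimensional ℝ V] {m : ℕ} {q : Fin m → V}
    (h : ∀ c : ℝ, 0 < c → c < 1 → ∃ t, ∀ i, c • q i - t ∈ K) :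
    ∃ t, ∀ i, q i - t ∈ K := by
  let S : Set (Fin m → V) := Set.pi Set.univ (fun _ => (K : Set V)) +
    (LinearMap.range (LinearMap.pi fun _ => LinearMap.id : V →ₗ[ℝ] Fin m → V) : Set _)
  have hS : ∀ a, a ∈ S ↔ ∃ t, ∀ i, a i - t ∈ K := by
    intro a
    constructor
    · rintro ⟨b, hb, _, ⟨t, rfl⟩, rfl⟩
      exact ⟨t, fun i => by simpa using hb i (Set.mem_univ i)⟩
    · rintro ⟨t, ht⟩
      exact ⟨fun i => a i - t, fun i _ => ht i, _, ⟨t, rfl⟩, by ext; simp⟩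
  have hclosed : IsClosed S :=
    (Submodule.closed_of_finiteDimensional _).add_left_of_isCompact
      (isCompact_univ_pi fun _ => K.isCompact)
  rw [← hS]
  have hlim : Filter.Tendsto (fun c : ℝ => c • q) (nhdsWithin 1 (Set.Iio 1)) (nhds q) := by
    have : Continuous fun c : ℝ => c • q := by fun_prop
    simpa using (this.tendsto 1).mono_left nhdsWithin_le_nhds
  refine hclosed.mem_of_tendsto hlim ?_
  filter_upwards [self_mem_nhdsWithin,
    mem_nhdsWithin_of_mem_nhds (Ioi_mem_nhds (zero_lt_one' ℝ))] with c h1 h0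
  exact (hS _).2 (h c h0 h1)

variable {T : ConvexBody (StrongDual ℝ V)}

lemma exists_erase_of_redundant (hK : (interior (K : Set V)).Nonempty) {k : ℕ}
    {q : Fin (k + 2) → V} {j : Fin (k + 2)}
    (hj : ¬ ∃ t, ∀ i, i ≠ j → q i - t ∈ interior (K : Set V)) :
    ∃ q' ∈ nonFittingPolygons (K : Set V) (k + 1),
      polygonLength (T : Set _) q' ≤ polygonLength (T : Set _) q := by
  obtain ⟨q', hle, hq'⟩ := exists_erase_vertex T q j
  refine ⟨q', (mem_nonFittingPolygons_iff hK _).2 ?_, hle⟩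
  rintro ⟨t, ht⟩
  refine hj ⟨t, fun i hi => ?_⟩
  obtain ⟨l, hl⟩ := hq' i hi
  exact hl ▸ ht l

lemma mem_frontier_of_apply_eq_asymNorm {p : StrongDual ℝ V} {v : V} (hp : p ∈ T) (hv : v ≠ 0)
    (h : p v = asymNorm (T : Set _) v) : p ∈ frontier (T : Set (StrongDual ℝ V)) := by
  refine ⟨subset_closure hp, fun hint => ?_⟩
  let ev : StrongDual ℝ (StrongDual ℝ V) := ContinuousLinearMap.apply ℝ ℝ v
  have hev : IsOuterNormal (T : Set _) ev p := by
    refine ⟨fun h0 => hv ?_, hp, fun y hy => ?_⟩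
    · exact SeparatingDual.eq_zero_of_forall_dual_eq_zero (R := ℝ) fun g =>
        congrArg (fun e : StrongDual ℝ (StrongDual ℝ V) => e g) h0
    · exact (apply_le_asymNorm T hy v).trans_eq h.symm
  exact lt_irrefl _ (apply_lt_of_isOuterNormal hev hint)

end nonFitting

/-! ### Existence of minimizers, and the trajectory they give -/

section minimum

variable {V : Type*} [NormedAddCommGroup V] [NormedSpace ℝ V] [FiniteDimensional ℝ V]
  {K : ConvexBody V} {T : ConvexBody (StrongDual ℝ V)}

lemma exists_isLeast_polygonLength [Nontrivial V] (hK : (interior (K : Set V)).Nonempty)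
    (hT0 : (0 : StrongDual ℝ V) ∈ interior (T : Set _)) (k : ℕ) :
    ∃ x, IsLeast (polygonLength (T : Set _) '' nonFittingPolygons (K : Set V) (k + 2)) x := by
  obtain ⟨c, hc, hcT⟩ := exists_mul_norm_le_asymNorm hT0
  obtain ⟨q₀, hq₀⟩ := nonFittingPolygons_nonempty hK k
  set l := polygonLength (T : Set _) q₀
  -- Pinning the first vertex at the origin removes the translation freedom; bounded length then
  -- gives compactness.
  let Q : Set (Fin (k + 2) → V) :=
    nonFittingPolygons (K : Set V) (k + 2) ∩ {q | q 0 = 0} ∩ {q | polygonLength (T : Set _) q ≤ l}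
  have normalize : ∀ q ∈ nonFittingPolygons (K : Set V) (k + 2), polygonLength (T : Set _) q ≤ l →
      (fun i => q i + -q 0) ∈ Q := fun q hq hql =>
    ⟨⟨nonFitting_add_const hK hq _, by simp⟩, (polygonLength_add_const _ q _).trans_le hql⟩
  have hclosed : IsClosed Q :=
    ((isClosed_nonFittingPolygons hK _).inter
      (isClosed_eq (by fun_prop) continuous_const)).inter
      (isClosed_le (continuous_polygonLength T _) continuous_const)
  have hbdd : Q ⊆ Metric.closedBall 0 ((k + 2) * (l / c)) := by
    rintro q ⟨⟨-, hq0 : q 0 = 0⟩, hql⟩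
    have hl : 0 ≤ l := polygonLength_nonneg hT0 _
    rw [mem_closedBall_zero_iff, pi_norm_le_iff_of_nonneg (by positivity)]
    intro i
    have h := norm_sub_zero_le hc hcT hT0 q i
    rw [hq0, sub_zero] at h
    refine h.trans (mul_le_mul ?_ (div_le_div_of_nonneg_right hql hc.le)
      (div_nonneg (polygonLength_nonneg hT0 _) hc.le) (by positivity))
    exact_mod_cast i.isLt.le
  have hcompact : IsCompact Q := (isCompact_closedBall _ _).of_isClosed_subset hclosed hbdd
  obtain ⟨q, hqQ, hmin⟩ := hcompact.exists_isMinOn ⟨_, normalize q₀ hq₀ le_rfl⟩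
    (continuous_polygonLength T _).continuousOn
  refine ⟨_, ⟨q, hqQ.1.1, rfl⟩, ?_⟩
  rintro _ ⟨q', hq', rfl⟩
  rcases le_total (polygonLength (T : Set _) q') l with h | h
  · exact (hmin (normalize q' hq' h)).trans_eq (polygonLength_add_const _ q' _)
  · exact hqQ.2.trans h

/-- Every non-fitting polygon can be replaced by one, not longer, with exactly `n + 1` vertices. -/
lemma exists_nonFitting_finrank_succ (hK : (interior (K : Set V)).Nonempty) (k : ℕ) :
    ∀ q ∈ nonFittingPolygons (K : Set V) (k + 1),
      ∃ q' ∈ nonFittingPolygons (K : Set V) (Module.finrank ℝ V + 1),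
        polygonLength (T : Set _) q' ≤ polygonLength (T : Set _) q := by
  -- Surplus vertices are erased by Helly; missing ones are supplied by repetition.
  rcases le_total (Module.finrank ℝ V) k with hk | hk
  · induction k, hk using Nat.le_induction with
    | base => exact fun q hq => ⟨q, hq, le_rfl⟩
    | succ k hk ih =>
      intro q hq
      obtain ⟨j, hj⟩ := exists_redundant_vertex hK (by omega) hq
      obtain ⟨q₁, hq₁, h₁⟩ := exists_erase_of_redundant (T := T) hK hj
      obtain ⟨q₂, hq₂, h₂⟩ := ih q₁ hq₁
      exact ⟨q₂, hq₂, h₂.trans h₁⟩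
  · induction hk using Nat.decreasingInduction with
    | self => exact fun q hq => ⟨q, hq, le_rfl⟩
    | of_succ k hk ih =>
      intro q hq
      obtain ⟨q₁, h₁, hr⟩ := exists_add_vertex T q
      obtain ⟨q₂, hq₂, h₂⟩ := ih q₁ (nonFitting_of_forall_mem_range hK hq hr)
      exact ⟨q₂, hq₂, h₂.trans_eq h₁⟩

lemma exists_eval_eq (ψ : StrongDual ℝ (StrongDual ℝ V)) : ∃ v : V, ∀ p, ψ p = p v := by
  let e : StrongDual ℝ V ≃ₗ[ℝ] Module.Dual ℝ V := LinearMap.toContinuousLinearMap.symm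
  refine ⟨(Module.evalEquiv ℝ V).symm (ψ.toLinearMap ∘ₗ e.symm.toLinearMap), fun p => ?_⟩
  have h := Module.apply_evalEquiv_symm_apply (R := ℝ) (M := V) (e p)
    (ψ.toLinearMap ∘ₗ e.symm.toLinearMap)
  simp only [LinearMap.comp_apply, LinearEquiv.coe_coe, LinearEquiv.symm_apply_apply] at h
  exact h.symm

/-- The functionals below `ℓ_T` are the differences of cyclic families of points of `T`. -/
lemma exists_momenta_of_le_polygonLength {m : ℕ} {g : Fin m → StrongDual ℝ V}
    (hg : ∀ q : Fin m → V, ∑ i, g i (q i) ≤ polygonLength (T : Set _) q) :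
    ∃ p : Fin m → StrongDual ℝ V, (∀ i, p i ∈ T) ∧ ∀ i, p i - p (finRotate m i) = g i := by
  let D : (Fin m → StrongDual ℝ V) →L[ℝ] (Fin m → StrongDual ℝ V) :=
    ContinuousLinearMap.pi fun i =>
      (ContinuousLinearMap.proj i : (Fin m → StrongDual ℝ V) →L[ℝ] StrongDual ℝ V) -
        ContinuousLinearMap.proj (finRotate m i)
  let C : Set (Fin m → StrongDual ℝ V) := D '' Set.pi Set.univ fun _ => (T : Set _)
  suffices hgC : g ∈ C by
    obtain ⟨p, hp, rfl⟩ := hgC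
    exact ⟨p, fun i => hp i (Set.mem_univ i), fun i => rfl⟩
  by_contra hgC
  have hCconv : Convex ℝ C := (convex_pi fun _ _ => T.convex).linear_image D.toLinearMap
  have hCcomp : IsCompact C := (isCompact_univ_pi fun _ => T.isCompact).image D.continuous
  obtain ⟨Φ, u, hΦC, hΦg⟩ := geometric_hahn_banach_closed_point hCconv hCcomp.isClosed hgC
  choose q hq using fun i => exists_eval_eq
    (Φ.comp (ContinuousLinearMap.single ℝ (fun _ : Fin m => StrongDual ℝ V) i))
  have hΦ : ∀ a, Φ a = ∑ i, a i (q i) := fun a => by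
    rw [continuousLinearMap_pi_apply]
    exact Finset.sum_congr rfl fun i _ => hq i (a i)
  -- Maximizing on each edge attains `ℓ_T(q)` on `C`, so the separation contradicts `hg`.
  choose p hpT hp using fun i =>
    exists_apply_eq_asymNorm T (q i - q ((finRotate m).symm i))
  have h1 := hΦC (D p) ⟨p, fun i _ => hpT i, rfl⟩
  have h2 : Φ (D p) = polygonLength (T : Set _) q := by
    rw [hΦ]
    refine (sum_sub_rotate_apply p q).trans (Finset.sum_congr rfl fun i _ => ?_)
    have h := hp (finRotate m i)
    rwa [Equiv.symm_apply_apply] at h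
  have h3 := hg q
  rw [← hΦ] at h3
  linarith

/-- A polygon inside `K` that is shortest among the non-fitting ones, with outer normals at its
vertices that sum to zero, is a billiard trajectory. -/
lemma isClosedBilliardTrajectory_of_shortest (hK : (interior (K : Set V)).Nonempty)
    (hT0 : (0 : StrongDual ℝ V) ∈ interior (T : Set _)) {m : ℕ} (hm : 1 ≤ m) {q : Fin m → V}
    (hmin : ∀ q' ∈ nonFittingPolygons (K : Set V) m,
      polygonLength (T : Set _) q ≤ polygonLength (T : Set _) q')
    (hne : ∀ i, q (finRotate m i) ≠ q i) {f : Fin m → StrongDual ℝ V}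
    (hf : ∀ i, IsOuterNormal (K : Set V) (f i) (q i)) (hsum : ∑ i, f i = 0) :
    IsClosedBilliardTrajectory (K : Set V) (T : Set _) q := by
  have hξ : 0 < polygonLength (T : Set _) q :=
    (asymNorm_pos hT0 (sub_ne_zero.2 (hne ⟨0, hm⟩))).trans_le
      (asymNorm_sub_le_polygonLength hT0 q _)
  set ξ := polygonLength (T : Set _) q with hξdef
  have hC : 0 < ∑ i, f i (q i) := by
    obtain ⟨x, hx⟩ := hK
    have h0 : ∑ i, f i x = 0 := by
      simpa using congrArg (fun g : StrongDual ℝ V => g x) hsum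
    rw [← h0]
    exact Finset.sum_lt_sum_of_nonempty ⟨⟨0, hm⟩, Finset.mem_univ _⟩
      fun i _ => apply_lt_of_isOuterNormal (hf i) hx
  set C := ∑ i, f i (q i) with hCdef
  -- When the sum is positive, rescale `q'` so that it equals `C`; the result is non-fitting and has
  -- length at least `ξ`.
  have hdom : ∀ q' : Fin m → V,
      ∑ i, ((ξ / C) • f i) (q' i) ≤ polygonLength (T : Set _) q' := by
    intro q'
    simp only [smul_apply, smul_eq_mul, ← Finset.mul_sum]
    rcases le_or_gt (∑ i, f i (q' i)) 0 with hneg | hpos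
    · exact (mul_nonpos_of_nonneg_of_nonpos (by positivity) hneg).trans
        (polygonLength_nonneg hT0 _)
    · set Λ := ∑ i, f i (q' i) with hΛ
      have hsc := hmin ((C / Λ) • q') (nonFitting_of_sum_normals_le hK hm hf hsum (by
        simp only [Pi.smul_apply, map_smul, smul_eq_mul, ← Finset.mul_sum]
        rw [← hΛ, div_mul_cancel₀ _ hpos.ne']))
      rw [polygonLength_smul T (by positivity)] at hsc
      have := mul_le_mul_of_nonneg_right hsc (by positivity : 0 ≤ Λ / C)
      calc ξ / C * Λ = ξ * (Λ / C) := by ring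
        _ ≤ _ := this
        _ = _ := by field_simp
  obtain ⟨p, hpT, hp⟩ := exists_momenta_of_le_polygonLength hdom
  have hle : ∀ i, p (finRotate m i) (q (finRotate m i) - q i) ≤
      asymNorm (T : Set _) (q (finRotate m i) - q i) := fun i => apply_le_asymNorm T (hpT _) _
  have heq : ∑ i, p (finRotate m i) (q (finRotate m i) - q i) =
      ∑ i, asymNorm (T : Set _) (q (finRotate m i) - q i) := by
    rw [← sum_sub_rotate_apply]
    simp only [hp, smul_apply, smul_eq_mul, ← Finset.mul_sum]
    rw [← hCdef, div_mul_cancel₀ _ hC.ne', hξdef, polygonLength]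
  -- Termwise inequalities with equal sums are equalities.
  have heq' := (Finset.sum_eq_sum_iff_of_le fun i _ => hle i).1 heq
  refine ⟨hne, fun i => ⟨subset_closure (hf i).2.1, fun hint => ?_⟩, p, fun i => ?_, fun i => ?_⟩
  · exact lt_irrefl _ (apply_lt_of_isOuterNormal (hf i) hint)
  · have h := heq' i (Finset.mem_univ i)
    exact ⟨mem_frontier_of_apply_eq_asymNorm (hpT _) (sub_ne_zero.2 (hne i)) h, h⟩
  · exact ⟨ξ / C, f i, by positivity, hf i, by rw [← hp i, neg_sub]⟩

/-- A shortest non-fitting polygon with the least possible number of vertices is, up to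
translation, a billiard trajectory. -/
lemma exists_trajectory_of_shortest (hK : (interior (K : Set V)).Nonempty)
    (hT0 : (0 : StrongDual ℝ V) ∈ interior (T : Set _)) {k : ℕ} {q : Fin (k + 2) → V}
    (hq : q ∈ nonFittingPolygons (K : Set V) (k + 2))
    (hmin : ∀ q' ∈ nonFittingPolygons (K : Set V) (k + 2),
      polygonLength (T : Set _) q ≤ polygonLength (T : Set _) q')
    (hfewer : ∀ q' ∈ nonFittingPolygons (K : Set V) (k + 1),
      polygonLength (T : Set _) q < polygonLength (T : Set _) q') :
    ∃ q' : Fin (k + 2) → V, IsClosedBilliardTrajectory (K : Set V) (T : Set _) q' ∧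
      polygonLength (T : Set _) q' = polygonLength (T : Set _) q := by
  have hirr : ∀ j, ∃ t, ∀ i, i ≠ j → q i - t ∈ interior (K : Set V) := by
    intro j
    by_contra hj
    obtain ⟨q', hq', hle⟩ := exists_erase_of_redundant (T := T) hK hj
    exact absurd hle (not_le.2 (hfewer q' hq'))
  have hne : ∀ i, q (finRotate (k + 2) i) ≠ q i := by
    intro i hi
    obtain ⟨t, ht⟩ := hirr i
    refine (mem_nonFittingPolygons_iff hK q).1 hq ⟨t, fun l => ?_⟩
    rcases eq_or_ne l i with rfl | hl
    · rw [← hi]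
      exact ht _ (by simp)
    · exact ht l hl
  have hξ : 0 < polygonLength (T : Set _) q :=
    (asymNorm_pos hT0 (sub_ne_zero.2 (hne 0))).trans_le (asymNorm_sub_le_polygonLength hT0 q _)
  -- A non-fitting `c • q` with `c < 1` would be shorter than `q`.
  obtain ⟨t, ht⟩ : ∃ t, ∀ i, q i - t ∈ K := by
    refine exists_translate_of_forall_smul fun c h0 h1 => ?_
    by_contra hc
    have hnf : c • q ∈ nonFittingPolygons (K : Set V) (k + 2) :=
      (mem_nonFittingPolygons_iff hK _).2 fun ⟨t, ht⟩ =>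
        hc ⟨t, fun i => interior_subset (ht i)⟩
    have := hmin _ hnf
    rw [polygonLength_smul T h0.le] at this
    nlinarith
  have hlen : polygonLength (T : Set _) (fun i => q i + -t) = polygonLength (T : Set _) q :=
    polygonLength_add_const _ q (-t)
  obtain ⟨f, hsum, ⟨l, hl⟩, hmax⟩ := exists_normals_sum_eq_zero hK
    (nonFitting_add_const hK hq (-t)) (fun i => by simpa [sub_eq_add_neg] using ht i)
  -- If `f j = 0`, moving the other vertices into the interior makes every nonzero `f i` positive on
  -- `s - t`, against the zero sum.
  have hf : ∀ i, f i ≠ 0 := by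
    intro j hj
    obtain ⟨s, hs⟩ := hirr j
    have h0 : ∑ i, f i (s - t) = 0 := by
      simpa using congrArg (fun g : StrongDual ℝ V => g (s - t)) hsum
    have hcomp : ∀ i, f i ≠ 0 → 0 < f i (s - t) := by
      intro i hi
      have hij : i ≠ j := fun h => hi (h ▸ hj)
      have := apply_lt_of_isOuterNormal (K := K) (x := q i + -t)
        ⟨hi, by simpa [sub_eq_add_neg] using ht i, hmax i⟩ (hs i hij)
      simp only [map_sub, map_add, map_neg] at this ⊢
      linarith
    refine h0.not_gt (Finset.sum_pos' (fun i _ => ?_) ⟨l, Finset.mem_univ l, hcomp l hl⟩)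
    rcases eq_or_ne (f i) 0 with h | h
    · simp [h]
    · exact (hcomp i h).le
  refine ⟨fun i => q i + -t, ?_, hlen⟩
  refine isClosedBilliardTrajectory_of_shortest hK hT0 (by omega) (fun q' hq' => ?_) (fun i => ?_)
    (fun i => ⟨hf i, by simpa [sub_eq_add_neg] using ht i, hmax i⟩) hsum
  · exact hlen.trans_le (hmin q' hq')
  · simpa using hne i

end minimum

end MinkowskiBilliard

theorem theorem1 {V : Type*} [NormedAddCommGroup V] [NormedSpace ℝ V] [FiniteDimensional ℝ V]
    (n : ℕ) (hn : Module.finrank ℝ V = n) (hn1 : 1 ≤ n)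
    (K : ConvexBody V) (hKint : (interior (K : Set V)).Nonempty)
    (hKsmooth : MinkowskiBilliard.IsSmoothBody (K : Set V))
    (T : ConvexBody (StrongDual ℝ V))
    (hT0 : (0 : StrongDual ℝ V) ∈ interior (T : Set (StrongDual ℝ V)))
    (hTsmooth : MinkowskiBilliard.IsSmoothBody (T : Set (StrongDual ℝ V))) :
    -- for each `m ≥ 2` the minimum over `𝒫_m(K)` exists (and `𝒫_1(K)` is empty)
    MinkowskiBilliard.nonFittingPolygons (K : Set V) 1 = ∅ ∧
    (∀ m : ℕ, 2 ≤ m → ∃ x : ℝ, IsLeast (MinkowskiBilliard.polygonLength (T : Set _) ''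
      MinkowskiBilliard.nonFittingPolygons (K : Set V) m) x) ∧
    ∃ ξ : ℝ,
      -- `ξ` is the length of the shortest closed billiard trajectory
      IsLeast {L : ℝ | ∃ m : ℕ, 1 ≤ m ∧ ∃ q : Fin m → V,
        MinkowskiBilliard.IsClosedBilliardTrajectory (K : Set V) (T : Set _) q ∧
        MinkowskiBilliard.polygonLength (T : Set _) q = L} ξ ∧
      -- `ξ` is the minimal length of the polygons that do not fit into a smaller homothet
      IsLeast {L : ℝ | ∃ m : ℕ, 1 ≤ m ∧ ∃ q ∈ MinkowskiBilliard.nonFittingPolygons (K : Set V) m,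
        MinkowskiBilliard.polygonLength (T : Set _) q = L} ξ ∧
      -- the latter minimum is attained with at most `n + 1` points
      ∃ m : ℕ, 1 ≤ m ∧ m ≤ n + 1 ∧
        ∃ q ∈ MinkowskiBilliard.nonFittingPolygons (K : Set V) m,
          MinkowskiBilliard.polygonLength (T : Set _) q = ξ := by
  subst hn
  have : Nontrivial V := Module.nontrivial_of_finrank_pos (R := ℝ) hn1
  refine ⟨MinkowskiBilliard.nonFittingPolygons_one hKint, fun m hm => ?_, ?_⟩
  · obtain ⟨k, rfl⟩ := Nat.exists_eq_add_of_le' hm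
    exact MinkowskiBilliard.exists_isLeast_polygonLength hKint hT0 k
  have hN : ∃ ξ, IsLeast (MinkowskiBilliard.polygonLength (T : Set _) ''
      MinkowskiBilliard.nonFittingPolygons (K : Set V) (Module.finrank ℝ V + 1)) ξ := by
    obtain ⟨k, hk⟩ := Nat.exists_eq_add_of_le' hn1
    rw [hk]
    exact MinkowskiBilliard.exists_isLeast_polygonLength hKint hT0 k
  obtain ⟨ξ, ⟨q₀, hq₀, hξ⟩, hmin⟩ := hN
  have hle : ∀ m, 1 ≤ m → ∀ q ∈ MinkowskiBilliard.nonFittingPolygons (K : Set V) m,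
      ξ ≤ MinkowskiBilliard.polygonLength (T : Set _) q := by
    intro m hm q hq
    obtain ⟨k, rfl⟩ := Nat.exists_eq_add_of_le' hm
    obtain ⟨q', hq', h⟩ := MinkowskiBilliard.exists_nonFitting_finrank_succ (T := T) hKint k q hq
    exact (hmin ⟨q', hq', rfl⟩).trans h
  refine ⟨ξ, ⟨?_, ?_⟩, ⟨⟨_, by omega, q₀, hq₀, hξ⟩, ?_⟩, _, by omega, le_rfl, q₀, hq₀, hξ⟩
  · classical
    have hex : ∃ k, ∃ q ∈ MinkowskiBilliard.nonFittingPolygons (K : Set V) (k + 1),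
        MinkowskiBilliard.polygonLength (T : Set _) q = ξ := ⟨_, q₀, hq₀, hξ⟩
    -- Choose the fewest vertices among minimizers; a single vertex always fits.
    rcases hk : Nat.find hex with _ | k
    · have hmem := Nat.find_spec hex
      rw [hk] at hmem
      obtain ⟨q, hq, -⟩ := hmem
      simp [MinkowskiBilliard.nonFittingPolygons_one hKint] at hq
    · have hmem := Nat.find_spec hex
      rw [hk] at hmem
      obtain ⟨q, hq, hqξ⟩ := hmem
      obtain ⟨q', htraj, hlen⟩ := MinkowskiBilliard.exists_trajectory_of_shortest hKint hT0 hq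
        (fun q' hq' => hqξ.trans_le (hle _ (by omega) q' hq'))
        (fun q' hq' => hqξ.trans_lt ((hle _ (by omega) q' hq').lt_of_ne fun h =>
          Nat.find_min hex (m := k) (by omega) ⟨q', hq', h.symm⟩))
      exact ⟨_, by omega, q', htraj, hlen.trans hqξ⟩
  · rintro _ ⟨m, hm, q, hq, rfl⟩
    exact hle m hm q (hq.mem_nonFittingPolygons hKint hm)
  · rintro _ ⟨m, hm, q, hq, rfl⟩
    exact hle m hm q hq
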